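/- **Theorem (discrete Stokes phenomenon).** Let $q>1$ be real and $p=1/q$. Put $$\theta_p(z)=\sum_{n\in\mathbb Z}p^{n(n-1)/2}z^n\quad(z\neq0),\qquad e_q(z)=\prod_{k\ge0}\bigl(1+(1-p)p^kz\bigr).$$ For $\lambda\in\mathbb C^*\smallsetminus\bigl(-(1-p)q^{\mathbb Z}\bigr)$ and $x\in\mathbb C^*\smallsetminus(-\lambda q^{\mathbb Z})$, the discrete $q$-Borel sum of the $q$-Euler series $\sum_{n\ge0}(-1)^n[n]_q^!\,x^{n+1}$ along $[\lambda]=\lambda q^{\mathbb Z}$ is $$\mathcal E_q^{[\lambda]}(x)=\frac{q}{1-p}\int_{\lambda p^{\mathbb Z}}\frac{1}{\left(1+\frac{\xi}{1-p}\right)e_q\!\left(\frac{q\,\xi}{(1-p)x}\right)}\,d_p\xi ,$$ where $\int_{\lambda p^{\mathbb Z}}f(\xi)\,d_p\xi$ is the Jackson integral, i.e. the limit of $\int_0^y f\,d_p\xi=(1-p)\,y\sum_{n\ge0}f(p^ny)p^n$ as $|y|\to\infty$, $y\in\lambda p^{\mathbb Z}$. Set $$K(a,b,x)=C\,\frac{\theta_p\!\left(-\frac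 ab\right)\theta_p\!\left(-\frac{1-p}{x}\right)\theta_p\!\left(-\frac{(1-p)ab}{x}\right)}{\theta_p(a)\,\theta_p(pb)\,\theta_p\!\left(\frac{(1-p)a}{x}\right)\theta_p\!\left(\frac{(1-p)b}{x}\right)} .$$ There is a constant $C\in\mathbb C$ depending only on $q$ such that, for all $\lambda,\mu\in\mathbb C^*\smallsetminus\bigl(-(1-p)q^{\mathbb Z}\bigr)$ and all $x\in\mathbb C^*\smallsetminus\bigl(-\lambda q^{\mathbb Z}\cup-\mu q^{\mathbb Z}\bigr)$, the Jackson integrals defining $\mathcal E_q^{[\lambda]}(x)$ and $\mathcal E_q^{[\mu]}(x)$ converge and $$\mathcal E_q^{[\lambda]}(x)-\mathcal E_q^{[\mu]}(x)=\frac{K\!\left(\frac{\lambda}{1-p},\frac{\mu}{1-p},x\right)}{e_q\!\left(-\frac qx\right)},$$ where at the points $x$ with $e_q(-q/x)=0$ (removable singularities of the right-hand side) the right-hand side is understood as its limit. -/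

import Mathlib

open Filter Topology

noncomputable section

namespace QEuler

/-! Throughout `q > 1` is real and `p = q⁻¹ ∈ (0,1)`. -/

/-- The theta function `θ_p(z) = ∑_{n ∈ ℤ} p^{n(n-1)/2} zⁿ` (for `0 < p < 1` and `z ≠ 0`);
the exponent `n(n-1)/2` is an exact integer division. -/
def theta (p : ℝ) (z : ℂ) : ℂ :=
  ∑' n : ℤ, (p : ℂ) ^ (n * (n - 1) / 2) * z ^ n

/-- The `q`-exponential `e_q(z) = (-(1-p)z; p)_∞ = ∏_{k ≥ 0} (1 + (1-p) p^k z)`, `p = q⁻¹`,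
an entire function for `q > 1`. -/
def qExp (q : ℝ) (z : ℂ) : ℂ :=
  ∏' k : ℕ, (1 + (1 - (q : ℂ)⁻¹) * ((q : ℂ)⁻¹) ^ k * z)

/-- The series `∑_{n ≥ 0} f(pⁿ y) pⁿ` defining the Jackson integral from `0` to `y` converges. -/
def JacksonSummable (p : ℝ) (f : ℂ → ℂ) (y : ℂ) : Prop :=
  Summable fun n : ℕ => f ((p : ℂ) ^ n * y) * (p : ℂ) ^ n

/-- The Jackson integral `∫_0^y f(t) d_p t = (1-p) y ∑_{n ≥ 0} f(pⁿ y) pⁿ`. -/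
def jacksonIntegral (p : ℝ) (f : ℂ → ℂ) (y : ℂ) : ℂ :=
  (1 - (p : ℂ)) * y * ∑' n : ℕ, f ((p : ℂ) ^ n * y) * (p : ℂ) ^ n

/-- The Jackson integral of `f` along the spiral `α p^ℤ` converges to `I`: all integrals
`∫_0^y f(t) d_p t`, `y ∈ α p^ℤ`, converge, and they tend to `I` as `|y| → ∞` on the spiral
(for `0 < p < 1`, this means `y = p^k α` with `k → -∞`). -/
def HasSpiralIntegral (p : ℝ) (f : ℂ → ℂ) (α : ℂ) (I : ℂ) : Prop :=
  (∀ k : ℤ, JacksonSummable p f ((p : ℂ) ^ k * α)) ∧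
    Tendsto (fun k : ℤ => jacksonIntegral p f ((p : ℂ) ^ k * α)) atBot (𝓝 I)

/-- The value of the Jackson integral of `f` along the spiral `α p^ℤ`. -/
def spiralIntegral (p : ℝ) (f : ℂ → ℂ) (α : ℂ) : ℂ :=
  limUnder atBot (fun k : ℤ => jacksonIntegral p f ((p : ℂ) ^ k * α))

/-- The `q`-Borel transform `ψ(ξ) = ∑ (-1)ⁿ ξⁿ = 1/(1+ξ)` of the `q`-Euler series
`∑ (-1)ⁿ [n]_q! x^{n+1}` (continued to `ξ ≠ -1`). -/
def psi (ξ : ℂ) : ℂ := 1 / (1 + ξ)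

/-- The integrand `ψ(ξ/(1-p)) / e_q(q ξ / ((1-p) x))` of the discrete `q`-Laplace transform. -/
def integrand (q : ℝ) (x : ℂ) (ξ : ℂ) : ℂ :=
  psi (ξ / (1 - (q : ℂ)⁻¹)) / qExp q (q * (ξ / ((1 - (q : ℂ)⁻¹) * x)))

/-- The discrete `q`-Borel sum of the `q`-Euler series along `[lam] = lam q^ℤ`:
`𝓔_q^{[lam]}(x) = q/(1-p) ∫_{lam p^ℤ} ψ(ξ/(1-p)) / e_q(q ξ / ((1-p) x)) d_p ξ`. -/
def discreteSum (q : ℝ) (lam x : ℂ) : ℂ :=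
  q / (1 - (q : ℂ)⁻¹) * spiralIntegral q⁻¹ (integrand q x) lam

/-- The Jackson integral defining `𝓔_q^{[lam]}(x)` converges. -/
def DiscreteSumConverges (q : ℝ) (lam x : ℂ) : Prop :=
  ∃ I : ℂ, HasSpiralIntegral q⁻¹ (integrand q x) lam I

/-- The theta quotient
`θ_p(-a/b) θ_p(-(1-p)/x) θ_p(-(1-p)ab/x) / (θ_p(a) θ_p(pb) θ_p((1-p)a/x) θ_p((1-p)b/x))`,
`p = q⁻¹`. -/
def thetaQuotient (q : ℝ) (a b x : ℂ) : ℂ :=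
  (theta q⁻¹ (-(a / b)) * theta q⁻¹ (-((1 - (q : ℂ)⁻¹) / x)) *
      theta q⁻¹ (-((1 - (q : ℂ)⁻¹) * a * b / x))) /
    (theta q⁻¹ a * theta q⁻¹ ((q : ℂ)⁻¹ * b) *
      theta q⁻¹ ((1 - (q : ℂ)⁻¹) * a / x) * theta q⁻¹ ((1 - (q : ℂ)⁻¹) * b / x))

end QEuler

end

/-! Put `a = λ/(1-p)`, `b = μ/(1-p)` and `t = (1-p)/x`. Up to the factor `q(1-p)`, the Jackson
integral is the two-sided series `bilateralSum p a (t * a)`, so the theorem compares its values at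
`a` and at `b` for fixed `t`.

Multiplying by `thetaProd p a * thetaProd p (t * a)` removes all poles. The result `regularSum p z
(t * z)` is holomorphic on `z ≠ 0`, and shifting the summation index shows that it satisfies `f(z) =
t z² f(pz)`. This equation is a two-step recursion on Laurent coefficients, so its solutions form a
space of dimension at most 2 (`exists_relation_of_isQuasiPeriodic`). The products `θ(z)θ(tz)` and
`θ(-z/b)θ(-tbz)` are also solutions. Evaluation at `z = b` and `z = -1` identifies the coefficients
of the sum in terms of them: the second product vanishes at `b`, the first at `-1`, and at `-1` only
one term of the series survives (`regularSum_neg_one`). Setting `z = a` gives `bilateralSum_sub`.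

The same dimension count in degree 1 shows that `theta` is a nonzero multiple κ of `thetaProd`; κ is
absorbed in `C`, so its value is not needed. At zeros of `e_q(-q/x)` the limit follows from
continuity of the discrete sums in `x`. -/

noncomputable section

namespace QEuler

/-! ### Laurent coefficients and quasi-periodic functions on the punctured plane -/

/-- The contour integral `∮ z^(-n-1) f(z) dz` over the circle `|z| = r`. -/
def laurentCoeff (f : ℂ → ℂ) (r : ℝ) (n : ℤ) : ℂ :=
  ∮ z in C(0, r), z ^ (-n - 1) * f z

lemma differentiableOn_zpow_mul {f : ℂ → ℂ} (hf : DifferentiableOn ℂ f {0}ᶜ) (n : ℤ) :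
    DifferentiableOn ℂ (fun z => z ^ n * f z) {0}ᶜ :=
  (differentiableOn_zpow n _ (Or.inl (by simp))).mul hf

lemma laurentCoeff_eq_of_le {f : ℂ → ℂ} (hf : DifferentiableOn ℂ f {0}ᶜ) {r R : ℝ}
    (hr : 0 < r) (h : r ≤ R) (n : ℤ) : laurentCoeff f R n = laurentCoeff f r n := by
  have hd := differentiableOn_zpow_mul hf (-n - 1)
  refine Complex.circleIntegral_eq_of_differentiable_on_annulus_off_countable hr h
    Set.countable_empty (hd.continuousOn.mono ?_) ?_
  · rintro z ⟨-, hz⟩ rfl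
    exact hz (by simpa using hr)
  · rintro z ⟨⟨-, hz⟩, -⟩
    refine hd.differentiableAt (isOpen_compl_singleton.mem_nhds ?_)
    rintro rfl
    exact hz (by simpa using hr.le)

lemma laurentCoeff_eq {f : ℂ → ℂ} (hf : DifferentiableOn ℂ f {0}ᶜ) {r R : ℝ}
    (hr : 0 < r) (hR : 0 < R) (n : ℤ) : laurentCoeff f R n = laurentCoeff f r n := by
  rcases le_total r R with h | h
  · exact laurentCoeff_eq_of_le hf hr h n
  · exact (laurentCoeff_eq_of_le hf hR h n).symm

lemma circleIntegral_comp_mul (g : ℂ → ℂ) (p : ℝ) :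
    (∮ z in C(0, 1), (p : ℂ) * g (p * z)) = ∮ z in C(0, p), g z := by
  simp only [circleIntegral, deriv_circleMap, circleMap_zero, smul_eq_mul]
  congr 1
  ext θ
  push_cast
  ring_nf

lemma circleIntegrable_zpow_mul {f : ℂ → ℂ} (hf : DifferentiableOn ℂ f {0}ᶜ) {r : ℝ}
    (hr : 0 < r) (n : ℤ) : CircleIntegrable (fun z => z ^ n * f z) 0 r := by
  refine ContinuousOn.circleIntegrable hr.le
    ((differentiableOn_zpow_mul hf n).continuousOn.mono ?_)
  rintro z hz rfl
  simp at hz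
  exact hr.ne hz

/-- On the circle through `z`, Laurent coefficients are Fourier coefficients up to nonzero factors.
If all vanish, the Fourier series is trivially summable, hence converges pointwise to the continuous
function `f`. -/
lemma eq_zero_of_laurentCoeff_eq_zero {f : ℂ → ℂ} (hf : DifferentiableOn ℂ f {0}ᶜ)
    (h : ∀ n, laurentCoeff f 1 n = 0) {z : ℂ} (hz : z ≠ 0) : f z = 0 := by
  have hr : 0 < ‖z‖ := norm_pos_iff.mpr hz
  set r := ‖z‖ with hr_def
  have : Fact (0 < 2 * Real.pi) := ⟨Real.two_pi_pos⟩
  have hne : ∀ θ, circleMap 0 r θ ≠ 0 := fun θ => circleMap_ne_center hr.ne'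
  have hper : Function.Periodic (fun θ : ℝ => f (circleMap 0 r θ)) (2 * Real.pi) :=
    (periodic_circleMap 0 r).comp f
  have hcont : Continuous fun θ : ℝ => f (circleMap 0 r θ) :=
    hf.continuousOn.comp_continuous (continuous_circleMap 0 r) (fun θ => hne θ)
  let F : C(AddCircle (2 * Real.pi), ℂ) :=
    ⟨hper.lift, by
      rw [continuous_coinduced_dom]
      exact hcont⟩
  have hF : ∀ θ : ℝ, F (θ : AddCircle (2 * Real.pi)) = f (circleMap 0 r θ) := fun θ => rfl
  have hcoeff : ∀ n : ℤ, fourierCoeff F n = 0 := by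
    intro n
    rw [fourierCoeff_eq_intervalIntegral _ n 0]
    have key := h n
    rw [laurentCoeff_eq hf hr one_pos n, laurentCoeff, circleIntegral] at key
    -- On `z = r e^{iθ}` one has `z^(-n-1) dz = i r^(-n) e^{-inθ} dθ`, whence the prefactor `r^n /
    -- i`.
    have : (∫ θ in (0 : ℝ)..0 + 2 * Real.pi,
        (fourier (-n) (θ : AddCircle (2 * Real.pi)) : ℂ) • F (θ : AddCircle (2 * Real.pi))) =
        ((r : ℂ) ^ n * Complex.I⁻¹) * ∫ θ in (0 : ℝ)..2 * Real.pi,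
          deriv (circleMap 0 r) θ •
            (circleMap 0 r θ ^ (-n - 1) * f (circleMap 0 r θ)) := by
      rw [zero_add, ← intervalIntegral.integral_const_mul]
      congr 1
      ext θ
      rw [hF, deriv_circleMap, fourier_coe_apply, smul_eq_mul, smul_eq_mul]
      have e1 : circleMap 0 r θ ^ (-n - 1) = circleMap 0 r θ ^ (-n) * (circleMap 0 r θ)⁻¹ := by
        rw [zpow_sub_one₀ (hne θ)]
      have e2 : circleMap 0 r θ ^ (-n) = (r : ℂ) ^ (-n) *
          Complex.exp (2 * Real.pi * Complex.I * (-n : ℤ) * θ / (2 * Real.pi : ℝ)) := by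
        rw [circleMap_zero, mul_zpow, ← Complex.exp_int_mul]
        congr 2
        have : (Real.pi : ℂ) ≠ 0 := by exact_mod_cast Real.pi_ne_zero
        push_cast
        field_simp
      have hrc : (r : ℂ) ^ n * (r : ℂ) ^ (-n) = 1 := by
        rw [← zpow_add₀ (by exact_mod_cast hr.ne')]
        simp
      rw [e1, e2]
      generalize Complex.exp (2 * Real.pi * Complex.I * (-n : ℤ) * θ / (2 * Real.pi : ℝ)) = E
      have h3 := hne θ
      have h4 : Complex.I⁻¹ * Complex.I = 1 := inv_mul_cancel₀ Complex.I_ne_zero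
      have h5 : circleMap 0 r θ * (circleMap 0 r θ)⁻¹ = 1 := mul_inv_cancel₀ h3
      linear_combination (-E * f (circleMap 0 r θ)) * (hrc + (r : ℂ) ^ n * (r : ℂ) ^ (-n) * h4 +
        (r : ℂ) ^ n * (r : ℂ) ^ (-n) * (Complex.I⁻¹ * Complex.I) * h5)
    rw [this, key]
    simp
  have hsum : Summable (fourierCoeff F) := by
    rw [show fourierCoeff F = fun _ => 0 from funext hcoeff]
    exact summable_zero
  have := has_pointwise_sum_fourier_series_of_summable hsum
    ((Complex.arg z : ℝ) : AddCircle (2 * Real.pi))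
  simp only [hcoeff, zero_smul] at this
  have h0 := this.unique hasSum_zero
  rw [hF, circleMap_zero, hr_def, Complex.norm_mul_exp_arg_mul_I] at h0
  exact h0

/-- Holomorphic functions on `ℂ \ {0}` with `f(z) = t z^k f(pz)`. -/
structure IsQuasiPeriodic (p : ℝ) (t : ℂ) (k : ℕ) (f : ℂ → ℂ) : Prop where
  diff : DifferentiableOn ℂ f {0}ᶜ
  eq : ∀ z, z ≠ 0 → f z = t * z ^ k * f (p * z)

/-- The functional equation turns the integral over `|z| = 1` into one over `|z| = p`, and the
radius does not matter. -/
lemma IsQuasiPeriodic.laurentCoeff_add {p : ℝ} {t : ℂ} {k : ℕ} {f : ℂ → ℂ} (hp : 0 < p)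
    (hf : IsQuasiPeriodic p t k f) (n : ℤ) :
    laurentCoeff f 1 (n + k) = t * (p : ℂ) ^ n * laurentCoeff f 1 n := by
  have hpc : (p : ℂ) ≠ 0 := by exact_mod_cast hp.ne'
  rw [laurentCoeff_eq hf.diff hp one_pos n]
  unfold laurentCoeff
  rw [← circleIntegral_comp_mul (fun z => z ^ (-n - 1) * f z),
    ← circleIntegral.integral_const_mul (t * (p : ℂ) ^ n)]
  refine circleIntegral.integral_congr zero_le_one ?_
  intro z hz
  have hz0 : z ≠ 0 := by
    rintro rfl
    simp at hz
  simp only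
  rw [hf.eq z hz0, mul_zpow]
  have e1 : z ^ (-(n + k : ℤ) - 1) * z ^ k = z ^ (-n - 1) := by
    rw [← zpow_natCast z k, ← zpow_add₀ hz0]
    congr 1
    ring
  have e2 : (p : ℂ) ^ n * p * (p : ℂ) ^ (-n - 1) = 1 := by
    rw [← zpow_add_one₀ hpc, ← zpow_add₀ hpc]
    simp
  linear_combination (t * f (p * z)) * e1 - (t * f (p * z) * z ^ (-n - 1)) * e2

/-- Since `t p^n ≠ 0`, the recursion runs in both directions, so a vanishing coefficient propagates
through its residue class mod `k`. -/
lemma IsQuasiPeriodic.eq_zero {p : ℝ} {t : ℂ} {k : ℕ} {f : ℂ → ℂ} (hp : 0 < p) (ht : t ≠ 0)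
    (hk : 0 < k) (hf : IsQuasiPeriodic p t k f) (h : ∀ i : Fin k, laurentCoeff f 1 (i : ℕ) = 0)
    {z : ℂ} (hz : z ≠ 0) : f z = 0 := by
  have hpc : (p : ℂ) ≠ 0 := by exact_mod_cast hp.ne'
  refine eq_zero_of_laurentCoeff_eq_zero hf.diff (fun n => ?_) hz
  have step : ∀ i j : ℤ, laurentCoeff f 1 i = 0 → laurentCoeff f 1 (i + k * j) = 0 := by
    intro i j hi
    induction j using Int.induction_on with
    | zero => simpa using hi
    | succ j ih =>
      rw [show i + (k : ℤ) * (j + 1) = i + k * j + k by ring, hf.laurentCoeff_add hp, ih, mul_zero]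
    | pred j ih =>
      have := hf.laurentCoeff_add hp (i + k * (-j - 1))
      rw [show i + (k : ℤ) * (-j - 1) + k = i + k * (-j) by ring, ih] at this
      simpa [ht, hpc, zpow_ne_zero] using this.symm
  have hk' : (0 : ℤ) < k := by exact_mod_cast hk
  have h1 := Int.emod_nonneg n hk'.ne'
  have h2 := Int.emod_lt_of_pos n hk'
  rw [← Int.emod_add_mul_ediv n k]
  refine step _ _ ?_
  have := h ⟨(n % k).toNat, by omega⟩
  simpa [Int.toNat_of_nonneg h1] using this

/-- Any `k + 1` quasi-periodic functions of degree `k` are linearly dependent. -/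
lemma exists_relation_of_isQuasiPeriodic {p : ℝ} {t : ℂ} {k : ℕ} (hp : 0 < p) (ht : t ≠ 0)
    (hk : 0 < k) (F : Fin (k + 1) → ℂ → ℂ) (hF : ∀ i, IsQuasiPeriodic p t k (F i)) :
    ∃ c : Fin (k + 1) → ℂ, c ≠ 0 ∧ ∀ z, z ≠ 0 → ∑ i, c i * F i z = 0 := by
  -- A combination is forced to vanish by `k` linear conditions on `k + 1` unknowns.
  let M : Matrix (Fin k) (Fin (k + 1)) ℂ := fun i j => laurentCoeff (F j) 1 (i : ℕ)
  have hker := LinearMap.ker_ne_bot_of_finrank_lt (f := M.mulVecLin) (by simp)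
  obtain ⟨c, hc, hc0⟩ := Submodule.exists_mem_ne_zero_of_ne_bot hker
  refine ⟨c, hc0, fun z hz => ?_⟩
  have hd : DifferentiableOn ℂ (fun z => ∑ i, c i * F i z) {0}ᶜ :=
    DifferentiableOn.fun_sum fun i _ => (hF i).diff.const_mul _
  refine IsQuasiPeriodic.eq_zero (f := fun z => ∑ i, c i * F i z) hp ht hk ⟨hd, ?_⟩ ?_ hz
  · intro z hz
    rw [Finset.mul_sum]
    refine Finset.sum_congr rfl fun i _ => ?_
    rw [(hF i).eq z hz]
    ring
  · intro i
    have : ∑ j, laurentCoeff (F j) 1 (i : ℕ) * c j = 0 :=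
      congrFun (LinearMap.mem_ker.mp hc) i
    rw [← this]
    unfold laurentCoeff
    simp only [Finset.mul_sum]
    rw [circleIntegral.integral_fun_sum]
    · refine Finset.sum_congr rfl fun j _ => ?_
      rw [mul_comm, ← circleIntegral.integral_const_mul]
      congr 1
      ext z
      ring
    · intro j _
      have := (circleIntegrable_zpow_mul ((hF j).diff.const_mul (c j)) one_pos (-(i : ℕ) - 1))
      exact this

/-! ### The infinite product `(-z; p)_∞` and the product form of the theta function -/

/-- The infinite product `(-z; p)_∞ = ∏_{k ≥ 0} (1 + p^k z)`. -/
def phi (p : ℝ) (z : ℂ) : ℂ := ∏' k : ℕ, (1 + (p : ℂ) ^ k * z)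

/-- The product `(-z; p)_∞ (-p/z; p)_∞`. -/
def thetaProd (p : ℝ) (z : ℂ) : ℂ := phi p z * phi p (p / z)

section phi

variable {p : ℝ} (hp0 : 0 < p) (hp1 : p < 1)

include hp0 hp1

lemma summable_norm_pow_mul (z : ℂ) : Summable fun k : ℕ => ‖(p : ℂ) ^ k * z‖ := by
  simp only [norm_mul, norm_pow, Complex.norm_real, Real.norm_of_nonneg hp0.le]
  exact (summable_geometric_of_lt_one hp0.le hp1).mul_right _

lemma multipliable_phi (z : ℂ) : Multipliable fun k : ℕ => (1 + (p : ℂ) ^ k * z) :=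
  multipliable_one_add_of_summable (summable_norm_pow_mul hp0 hp1 z)

lemma phi_eq_mul (z : ℂ) : phi p z = (1 + z) * phi p (p * z) := by
  have h : (fun k : ℕ => (1 + (p : ℂ) ^ (k + 1) * z)) = fun k : ℕ => 1 + (p : ℂ) ^ k * (p * z) := by
    ext k
    ring
  unfold phi
  rw [tprod_eq_zero_mul' (by rw [h]; exact multipliable_phi hp0 hp1 (p * z)), h]
  simp

lemma phi_ne_zero {z : ℂ} (h : ∀ k : ℕ, 1 + (p : ℂ) ^ k * z ≠ 0) : phi p z ≠ 0 :=
  tprod_one_add_ne_zero_of_summable h (summable_norm_pow_mul hp0 hp1 z)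

lemma differentiable_phi : Differentiable ℂ (phi p) := by
  intro z
  have hu : Summable fun k : ℕ => p ^ k * (‖z‖ + 1) :=
    (summable_geometric_of_lt_one hp0.le hp1).mul_right _
  have h := Summable.hasProdLocallyUniformlyOn_nat_one_add (f := fun (k : ℕ) (z : ℂ) => (p : ℂ) ^ k * z)
    (K := Metric.ball 0 (‖z‖ + 1)) Metric.isOpen_ball hu
    (Eventually.of_forall fun k x hx => by
      rw [norm_mul, norm_pow, Complex.norm_real, Real.norm_of_nonneg hp0.le]
      gcongr
      simpa using (mem_ball_zero_iff.mp hx).le)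
    (fun k => by fun_prop)
  have hd : DifferentiableOn ℂ (phi p) (Metric.ball 0 (‖z‖ + 1)) :=
    h.differentiableOn (.of_forall fun _ => by
      simpa [Finset.prod_fn] using DifferentiableOn.finsetProd (fun _ _ => by fun_prop))
      Metric.isOpen_ball
  exact hd.differentiableAt (Metric.isOpen_ball.mem_nhds (by simp))

omit hp0 hp1 in
lemma phi_zero : phi p 0 = 1 := by simp [phi]

/-- Factorwise, `|1 + p^k z| ≤ 1 + p^k |z|`. Estimates are thereby moved to the positive axis, where
`phi` has no zeros. -/
lemma norm_phi_le (z : ℂ) : ‖phi p z‖ ≤ ‖phi p (‖z‖ : ℝ)‖ := by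
  unfold phi
  rw [(multipliable_phi hp0 hp1 z).norm_tprod, (multipliable_phi hp0 hp1 (‖z‖ : ℝ)).norm_tprod]
  have h1 := (multipliable_phi hp0 hp1 z).norm.hasProd
  have h2 := (multipliable_phi hp0 hp1 (‖z‖ : ℝ)).norm.hasProd
  refine le_of_tendsto_of_tendsto' h1 h2 fun s => ?_
  refine Finset.prod_le_prod (fun _ _ => norm_nonneg _) fun k _ => ?_
  have : (1 : ℂ) + (p : ℂ) ^ k * (‖z‖ : ℝ) = ((1 + p ^ k * ‖z‖ : ℝ) : ℂ) := by push_cast; ring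
  rw [this, Complex.norm_real, Real.norm_of_nonneg (by positivity)]
  refine (norm_add_le _ _).trans ?_
  simp [abs_of_pos hp0]

lemma one_le_norm_phi {r : ℝ} (hr : 0 ≤ r) : 1 ≤ ‖phi p r‖ := by
  unfold phi
  rw [(multipliable_phi hp0 hp1 r).norm_tprod]
  have h2 := (multipliable_phi hp0 hp1 r).norm.hasProd
  refine ge_of_tendsto' h2 fun s => ?_
  rw [← Finset.prod_const_one (s := s)]
  refine Finset.prod_le_prod (fun _ _ => zero_le_one) fun k _ => ?_
  have : (1 : ℂ) + (p : ℂ) ^ k * r = ((1 + p ^ k * r : ℝ) : ℂ) := by push_cast; ring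
  rw [this, Complex.norm_real, Real.norm_of_nonneg (by positivity)]
  have : 0 ≤ p ^ k * r := by positivity
  linarith

lemma one_add_le_norm_phi {r : ℝ} (hr : 0 ≤ r) : 1 + r ≤ ‖phi p r‖ := by
  have e : (1 : ℂ) + (r : ℂ) = ((1 + r : ℝ) : ℂ) := by push_cast; ring
  rw [phi_eq_mul hp0 hp1, norm_mul, ← Complex.ofReal_mul, e, Complex.norm_real,
    Real.norm_of_nonneg (by linarith)]
  exact le_mul_of_one_le_right (by linarith) (one_le_norm_phi hp0 hp1 (by positivity))

lemma thetaProd_eq_mul {z : ℂ} (hz : z ≠ 0) : thetaProd p z = z * thetaProd p (p * z) := by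
  have hpc : (p : ℂ) ≠ 0 := by exact_mod_cast hp0.ne'
  unfold thetaProd
  rw [phi_eq_mul hp0 hp1 z, phi_eq_mul hp0 hp1 (p / (p * z)),
    show (p : ℂ) * (p / (p * z)) = p / z by field_simp]
  field_simp
  ring

lemma differentiableOn_thetaProd : DifferentiableOn ℂ (thetaProd p) {0}ᶜ := by
  intro z hz
  have hz : z ≠ 0 := hz
  have h := differentiable_phi hp0 hp1
  have h2 : DifferentiableAt ℂ (fun z => phi p (p / z)) z :=
    (h _).comp (f := fun z : ℂ => (p : ℂ) / z) z (by fun_prop (disch := assumption))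
  exact ((h z).mul h2).differentiableWithinAt

lemma thetaProd_neg_one : thetaProd p (-1) = 0 := by
  rw [thetaProd, phi_eq_mul hp0 hp1]
  simp

omit hp1 in
lemma thetaProd_mul_eq_inv (z : ℂ) : thetaProd p (p * z) = thetaProd p z⁻¹ := by
  have hpc : (p : ℂ) ≠ 0 := by exact_mod_cast hp0.ne'
  unfold thetaProd
  rw [div_mul_cancel_left₀ hpc, div_inv_eq_mul, mul_comm]

lemma thetaProd_ne_zero {z : ℂ} (hz : z ≠ 0) (h : ∀ n : ℤ, 1 + (p : ℂ) ^ n * z ≠ 0) :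
    thetaProd p z ≠ 0 := by
  have hpc : (p : ℂ) ≠ 0 := by exact_mod_cast hp0.ne'
  refine mul_ne_zero (phi_ne_zero hp0 hp1 fun k => by simpa using h k)
    (phi_ne_zero hp0 hp1 fun k hk => h (-(k + 1 : ℕ)) ?_)
  rw [zpow_neg, zpow_natCast]
  field_simp at hk
  field_simp
  linear_combination hk

lemma isQuasiPeriodic_thetaProd : IsQuasiPeriodic p 1 1 (thetaProd p) :=
  ⟨differentiableOn_thetaProd hp0 hp1, fun z hz => by
    rw [thetaProd_eq_mul hp0 hp1 hz]; ring⟩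

omit hp1 in
lemma triangle_zpow_succ (n : ℤ) : (p : ℂ) ^ ((n + 1) * (n + 1 - 1) / 2) =
    (p : ℂ) ^ (n * (n - 1) / 2) * (p : ℂ) ^ n := by
  have hpc : (p : ℂ) ≠ 0 := by exact_mod_cast hp0.ne'
  rw [← zpow_add₀ hpc]
  congr 1
  rw [show (n + 1) * (n + 1 - 1) = n * (n - 1) + n * 2 by ring, Int.add_mul_ediv_right _ _ two_ne_zero]

lemma thetaProd_eq_zpow_mul {z : ℂ} (hz : z ≠ 0) (n : ℤ) :
    thetaProd p z = (p : ℂ) ^ (n * (n - 1) / 2) * z ^ n * thetaProd p ((p : ℂ) ^ n * z) := by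
  have hpc : (p : ℂ) ≠ 0 := by exact_mod_cast hp0.ne'
  have step : ∀ n : ℤ, (p : ℂ) ^ (n * (n - 1) / 2) * z ^ n * thetaProd p ((p : ℂ) ^ n * z) =
      (p : ℂ) ^ ((n + 1) * (n + 1 - 1) / 2) * z ^ (n + 1) *
        thetaProd p ((p : ℂ) ^ (n + 1) * z) := by
    intro n
    rw [triangle_zpow_succ hp0, thetaProd_eq_mul hp0 hp1 (mul_ne_zero (zpow_ne_zero n hpc) hz),
      zpow_add_one₀ hz, zpow_add_one₀ hpc, mul_comm ((p : ℂ) ^ n) (p : ℂ), mul_assoc (p : ℂ)]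
    ring
  induction n using Int.induction_on with
  | zero => simp
  | succ j ih => rw [ih, step]
  | pred j ih => rw [ih, step (-j - 1), sub_add_cancel]

end phi

/-! ### Quotients of the theta product by its factors -/

/-- The quotient `thetaProd p w / phi p (p^m w)`, in a form holomorphic on `w ≠ 0`. -/
def thetaDivPhi (p : ℝ) (m : ℤ) (w : ℂ) : ℂ :=
  (p : ℂ) ^ (m * (m - 1) / 2) * w ^ m * phi p (p / ((p : ℂ) ^ m * w))

/-- The quotient `thetaProd p a / (1 + p^n a)`, in a form holomorphic on `a ≠ 0`. -/
def thetaDivFactor (p : ℝ) (n : ℤ) (a : ℂ) : ℂ :=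
  thetaDivPhi p n a * phi p (p * ((p : ℂ) ^ n * a))

section quotients

variable {p : ℝ} (hp0 : 0 < p) (hp1 : p < 1)

include hp0 hp1

/-- Iterated quasi-periodicity exhibits `phi p (p^m w)` as an explicit factor of `thetaProd p w`;
the quotient is what remains, so it makes sense at the zeros too. -/
lemma thetaDivPhi_mul (m : ℤ) {w : ℂ} (hw : w ≠ 0) :
    thetaDivPhi p m w * phi p ((p : ℂ) ^ m * w) = thetaProd p w := by
  rw [thetaProd_eq_zpow_mul hp0 hp1 hw m, thetaDivPhi, thetaProd]
  ring

lemma thetaDivFactor_mul (n : ℤ) {a : ℂ} (ha : a ≠ 0) :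
    thetaDivFactor p n a * (1 + (p : ℂ) ^ n * a) = thetaProd p a := by
  rw [← thetaDivPhi_mul hp0 hp1 n ha, thetaDivFactor, phi_eq_mul hp0 hp1 ((p : ℂ) ^ n * a)]
  ring

lemma norm_thetaDivPhi_le (m : ℤ) (w : ℂ) :
    ‖thetaDivPhi p m w‖ ≤ ‖thetaDivPhi p m (‖w‖ : ℝ)‖ := by
  unfold thetaDivPhi
  simp only [norm_mul, norm_zpow, Complex.norm_real, Real.norm_of_nonneg hp0.le, norm_norm]
  refine mul_le_mul_of_nonneg_left ?_ (by positivity)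
  refine (norm_phi_le hp0 hp1 _).trans_eq ?_
  simp [abs_of_pos hp0]

/-- At `|w|` the removed factor is at least `1 + p^m |w|`. The bound is uniform in `m` and gives
geometric decay as `m → -∞`. -/
lemma norm_thetaDivPhi_mul_le (m : ℤ) {w : ℂ} (hw : w ≠ 0) :
    ‖thetaDivPhi p m w‖ * (1 + p ^ m * ‖w‖) ≤ ‖thetaProd p (‖w‖ : ℝ)‖ := by
  have hw' : ((‖w‖ : ℝ) : ℂ) ≠ 0 := by simpa using hw
  rw [← thetaDivPhi_mul hp0 hp1 m hw', norm_mul]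
  gcongr
  · exact norm_thetaDivPhi_le hp0 hp1 m w
  · have := one_add_le_norm_phi hp0 hp1 (r := p ^ m * ‖w‖) (by positivity)
    exact_mod_cast this

lemma norm_thetaDivFactor_mul_le (n : ℤ) {a : ℂ} (ha : a ≠ 0) :
    ‖thetaDivFactor p n a‖ * (1 + p ^ n * ‖a‖) ≤ ‖thetaProd p (‖a‖ : ℝ)‖ := by
  have ha' : ((‖a‖ : ℝ) : ℂ) ≠ 0 := by simpa using ha
  have e : (1 : ℂ) + (p : ℂ) ^ n * (‖a‖ : ℝ) = ((1 + p ^ n * ‖a‖ : ℝ) : ℂ) := by push_cast; ring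
  rw [← thetaDivFactor_mul hp0 hp1 n ha', norm_mul, e, Complex.norm_real,
    Real.norm_of_nonneg (by positivity)]
  gcongr
  unfold thetaDivFactor
  rw [norm_mul, norm_mul]
  gcongr
  · exact norm_thetaDivPhi_le hp0 hp1 n a
  · refine (norm_phi_le hp0 hp1 _).trans_eq ?_
    simp [abs_of_pos hp0]

lemma differentiableOn_thetaDivPhi (m : ℤ) : DifferentiableOn ℂ (thetaDivPhi p m) {0}ᶜ := by
  have hpc : (p : ℂ) ≠ 0 := by exact_mod_cast hp0.ne'
  intro z hz
  have hz : z ≠ 0 := hz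
  have hz' : (p : ℂ) ^ m * z ≠ 0 := mul_ne_zero (zpow_ne_zero m hpc) hz
  have h2 : DifferentiableAt ℂ (fun z => phi p (p / ((p : ℂ) ^ m * z))) z :=
    (differentiable_phi hp0 hp1 _).comp (f := fun z : ℂ => (p : ℂ) / ((p : ℂ) ^ m * z)) z
      (by fun_prop (disch := assumption))
  exact (((differentiableAt_zpow.mpr (Or.inl hz)).const_mul _).mul h2).differentiableWithinAt

lemma differentiableOn_thetaDivFactor (n : ℤ) :
    DifferentiableOn ℂ (thetaDivFactor p n) {0}ᶜ := by
  refine (differentiableOn_thetaDivPhi hp0 hp1 n).mul (Differentiable.differentiableOn ?_)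
  exact (differentiable_phi hp0 hp1).comp (by fun_prop)

omit hp1 in
lemma thetaDivPhi_mul_left (m : ℤ) {w : ℂ} (hw : w ≠ 0) :
    thetaDivPhi p (m + 1) w = w * thetaDivPhi p m (p * w) := by
  have hpc : (p : ℂ) ≠ 0 := by exact_mod_cast hp0.ne'
  unfold thetaDivPhi
  rw [triangle_zpow_succ hp0, mul_zpow, zpow_add_one₀ hw, zpow_add_one₀ hpc,
    mul_assoc ((p : ℂ) ^ m) (p : ℂ) w]
  ring

omit hp1 in
lemma thetaDivFactor_mul_left (n : ℤ) {a : ℂ} (ha : a ≠ 0) :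
    thetaDivFactor p (n + 1) a = a * thetaDivFactor p n (p * a) := by
  have hpc : (p : ℂ) ≠ 0 := by exact_mod_cast hp0.ne'
  unfold thetaDivFactor
  rw [thetaDivPhi_mul_left hp0 n ha, zpow_add_one₀ hpc, mul_assoc ((p : ℂ) ^ n) (p : ℂ) a]
  ring

end quotients

/-! ### Locally dominated series on the punctured plane -/

lemma summable_pow_natAbs {p : ℝ} (hp0 : 0 < p) (hp1 : p < 1) :
    Summable fun n : ℤ => p ^ n.natAbs := by
  have h := summable_geometric_of_lt_one hp0.le hp1
  exact Summable.of_nat_of_neg (by simpa using h) (by simpa using h)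

lemma differentiableOn_tsum_of_locally_bounded {ι : Type*} {F : ι → ℂ → ℂ} {M : ℂ → ℝ}
    {u : ι → ℝ} (hF : ∀ n, DifferentiableOn ℂ (F n) {0}ᶜ) (hM : ContinuousOn M {0}ᶜ)
    (hu : Summable u) (hu0 : ∀ n, 0 ≤ u n) (hle : ∀ n z, z ≠ 0 → ‖F n z‖ ≤ M z * u n) :
    DifferentiableOn ℂ (fun z => ∑' n, F n z) {0}ᶜ := by
  intro z hz
  have hU := hM.isOpen_inter_preimage isOpen_compl_singleton (isOpen_Iio (a := M z + 1))
  have hd := Complex.differentiableOn_tsum_of_summable_norm (hu.mul_left (M z + 1))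
    (fun n => (hF n).mono Set.inter_subset_left) hU
    (fun n w hw => (hle n w hw.1).trans (mul_le_mul_of_nonneg_right (le_of_lt hw.2) (hu0 n)))
  exact (hd.differentiableAt (hU.mem_nhds ⟨hz, by simp⟩)).differentiableWithinAt

section

variable {p : ℝ} (hp0 : 0 < p) (hp1 : p < 1)

include hp0 hp1

lemma continuousOn_norm_thetaProd_norm {α : ℂ → ℂ} (hα : ContinuousOn α {0}ᶜ)
    (hα0 : ∀ z, z ≠ 0 → α z ≠ 0) :
    ContinuousOn (fun z => ‖thetaProd p (‖α z‖ : ℝ)‖) {0}ᶜ := by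
  refine ((differentiableOn_thetaProd hp0 hp1).continuousOn.comp
    (Complex.continuous_ofReal.comp_continuousOn hα.norm) ?_).norm
  intro z hz
  simpa using hα0 z hz

/-! ### The theta function is a multiple of the theta product -/

omit hp0 hp1 in
lemma zpow_eq_inv_pow_natAbs {n : ℤ} (hn : n ≤ 0) : (p ^ n)⁻¹ = p ^ n.natAbs := by
  rw [← zpow_neg, ← zpow_natCast]
  congr 1
  omega

omit hp0 hp1 in
lemma zpow_eq_pow_natAbs {n : ℤ} (hn : 0 ≤ n) : p ^ n = p ^ n.natAbs := by
  rw [← zpow_natCast]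
  congr 1
  omega

/-- The term is `thetaDivPhi` stripped of its remaining `phi` factor, so both removed factors can be
used: `1 + p/(p^n |z|)` gives decay for `n ≥ 0`, and `1 + p^n |z|` for `n ≤ 0`. -/
lemma norm_theta_term_le (n : ℤ) {z : ℂ} (hz : z ≠ 0) :
    ‖(p : ℂ) ^ (n * (n - 1) / 2) * z ^ n‖ ≤
      ‖thetaProd p (‖z‖ : ℝ)‖ * (‖z‖ / p + ‖z‖⁻¹) * p ^ n.natAbs := by
  have hr : 0 < ‖z‖ := norm_pos_iff.mpr hz
  have h1 := norm_thetaDivPhi_mul_le hp0 hp1 n (w := (‖z‖ : ℝ)) (by simpa using hz)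
  have h2 := one_add_le_norm_phi hp0 hp1 (r := p / (p ^ n * ‖z‖)) (by positivity)
  set x := ‖(p : ℂ) ^ (n * (n - 1) / 2) * z ^ n‖ with hx
  have hx' : ‖thetaDivPhi p n (‖z‖ : ℝ)‖ = x * ‖phi p (p / (p ^ n * ‖z‖) : ℝ)‖ := by
    simp [thetaDivPhi, hx]
  rw [hx', Complex.norm_real, norm_norm] at h1
  set Q := ‖thetaProd p (‖z‖ : ℝ)‖
  have hx0 : 0 ≤ x := norm_nonneg _
  have hk : 0 < p ^ n := zpow_pos hp0 n
  have h3 : x * (1 + p / (p ^ n * ‖z‖)) * (1 + p ^ n * ‖z‖) ≤ Q :=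
    (mul_le_mul_of_nonneg_right (mul_le_mul_of_nonneg_left h2 hx0) (by positivity)).trans h1
  have hQ : 0 ≤ Q := norm_nonneg _
  have hA : 0 ≤ x * (p / (p ^ n * ‖z‖)) := by positivity
  have hB : 0 ≤ x * (p ^ n * ‖z‖) := by positivity
  have hAB : 0 ≤ x * (p / (p ^ n * ‖z‖)) * (p ^ n * ‖z‖) := by positivity
  rcases le_total 0 n with hn | hn
  · have h4 : x * (p / (p ^ n * ‖z‖)) ≤ Q := by nlinarith
    rw [← zpow_eq_pow_natAbs hn]
    calc x = x * (p / (p ^ n * ‖z‖)) * (‖z‖ / p * p ^ n) := by field_simp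
      _ ≤ Q * (‖z‖ / p * p ^ n) := by gcongr
      _ = Q * (‖z‖ / p) * p ^ n := by ring
      _ ≤ Q * (‖z‖ / p + ‖z‖⁻¹) * p ^ n := by
        gcongr
        exact le_add_of_nonneg_right (by positivity)
  · have h4 : x * (p ^ n * ‖z‖) ≤ Q := by nlinarith
    rw [← zpow_eq_inv_pow_natAbs hn]
    calc x = x * (p ^ n * ‖z‖) * (‖z‖⁻¹ * (p ^ n)⁻¹) := by field_simp
      _ ≤ Q * (‖z‖⁻¹ * (p ^ n)⁻¹) := by gcongr
      _ = Q * ‖z‖⁻¹ * (p ^ n)⁻¹ := by ring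
      _ ≤ Q * (‖z‖ / p + ‖z‖⁻¹) * (p ^ n)⁻¹ := by
        gcongr
        exact le_add_of_nonneg_left (by positivity)

lemma isQuasiPeriodic_theta : IsQuasiPeriodic p 1 1 (theta p) := by
  have hpc : (p : ℂ) ≠ 0 := by exact_mod_cast hp0.ne'
  constructor
  · refine differentiableOn_tsum_of_locally_bounded
      (M := fun z => ‖thetaProd p (‖z‖ : ℝ)‖ * (‖z‖ / p + ‖z‖⁻¹)) (fun n => ?_) ?_
      (summable_pow_natAbs hp0 hp1) (fun n => by positivity)
      (fun n z hz => norm_theta_term_le hp0 hp1 n hz)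
    · exact (differentiableOn_zpow n _ (Or.inl (by simp))).const_mul _
    · refine (continuousOn_norm_thetaProd_norm hp0 hp1 continuousOn_id fun z hz => hz).mul ?_
      refine ContinuousOn.add (by fun_prop) (ContinuousOn.inv₀ (by fun_prop) ?_)
      intro z hz
      simpa using hz
  · intro z hz
    unfold theta
    rw [← tsum_mul_left, ← (Equiv.addRight (1 : ℤ)).tsum_eq]
    congr 1
    ext n
    rw [Equiv.coe_addRight, triangle_zpow_succ hp0, zpow_add_one₀ hz, mul_zpow]
    ring

lemma theta_one_ne_zero : theta p 1 ≠ 0 := by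
  have hs : Summable fun n : ℤ => p ^ (n * (n - 1) / 2) := by
    refine ((summable_pow_natAbs hp0 hp1).mul_left
      (‖thetaProd p (‖(1 : ℂ)‖ : ℝ)‖ * (‖(1 : ℂ)‖ / p + ‖(1 : ℂ)‖⁻¹))).of_norm_bounded
      fun n => ?_
    simpa using norm_theta_term_le hp0 hp1 n one_ne_zero
  have : theta p 1 = ((∑' n : ℤ, p ^ (n * (n - 1) / 2) : ℝ) : ℂ) := by
    simp [theta, Complex.ofReal_tsum]
  rw [this]
  exact_mod_cast (hs.tsum_pos (fun n => by positivity) 0 (by simp)).ne'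

/-- Both functions solve the degree 1 equation, so they are proportional; neither vanishes at `1`,
which makes κ finite and nonzero. -/
lemma exists_theta_eq : ∃ κ : ℂ, κ ≠ 0 ∧ ∀ z, z ≠ 0 → theta p z = κ * thetaProd p z := by
  obtain ⟨c, hc, h⟩ := exists_relation_of_isQuasiPeriodic hp0 one_ne_zero one_pos
    ![theta p, thetaProd p] (fun i => by
      fin_cases i
      · exact isQuasiPeriodic_theta hp0 hp1
      · exact isQuasiPeriodic_thetaProd hp0 hp1)
  replace h : ∀ z, z ≠ 0 → c 0 * theta p z + c 1 * thetaProd p z = 0 := fun z hz => by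
    simpa [Fin.sum_univ_succ] using h z hz
  have h1 := theta_one_ne_zero hp0 hp1
  have h2 : thetaProd p 1 ≠ 0 := by
    refine thetaProd_ne_zero hp0 hp1 one_ne_zero fun n => ?_
    have : (1 : ℂ) + (p : ℂ) ^ n * 1 = ((1 + p ^ n : ℝ) : ℂ) := by push_cast; ring
    rw [this]
    exact_mod_cast (by positivity : (1 + p ^ n : ℝ) ≠ 0)
  have h3 := h 1 one_ne_zero
  have hc0 : c 0 ≠ 0 := by
    intro h0
    apply hc
    ext i
    fin_cases i
    · exact h0
    · simpa [h0, h2] using h3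
  have hc1 : c 1 ≠ 0 := by
    intro h0
    simp [h0, h1, hc0] at h3
  refine ⟨-c 1 / c 0, div_ne_zero (neg_ne_zero.mpr hc1) hc0, fun z hz => ?_⟩
  field_simp
  linear_combination h z hz

/-! ### The bilateral sum -/

omit hp0 hp1 in
/-- The terms of `thetaProd p a * thetaProd p w * bilateralSum p a w`. -/
def bilateralTerm (p : ℝ) (n : ℤ) (a w : ℂ) : ℂ :=
  (p : ℂ) ^ n * a * thetaDivFactor p n a * thetaDivPhi p (n - 1) w

omit hp0 hp1 in
/-- The sum `∑_{n ∈ ℤ} p^n a / ((1 + p^n a) (-p^(n-1) w; p)_∞)`. -/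
def bilateralSum (p : ℝ) (a w : ℂ) : ℂ :=
  ∑' n : ℤ, (p : ℂ) ^ n * a / ((1 + (p : ℂ) ^ n * a) * phi p ((p : ℂ) ^ (n - 1) * w))

omit hp0 hp1 in
/-- The sum `thetaProd p a * thetaProd p w * bilateralSum p a w`, holomorphic in `a, w ≠ 0`. -/
def regularSum (p : ℝ) (a w : ℂ) : ℂ := ∑' n : ℤ, bilateralTerm p n a w

/-- For `n ≥ 0` the prefactor `p^n` decays. For `n ≤ 0` it is absorbed by the removed factor `1 +
p^n |a|`, and the decay comes from `1 + p^(n-1) |w|`. -/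
lemma norm_bilateralTerm_le (n : ℤ) {a w : ℂ} (ha : a ≠ 0) (hw : w ≠ 0) :
    ‖bilateralTerm p n a w‖ ≤ ‖thetaProd p (‖a‖ : ℝ)‖ * ‖thetaProd p (‖w‖ : ℝ)‖ *
      (‖a‖ + p * ‖w‖⁻¹) * p ^ n.natAbs := by
  have hra : 0 < ‖a‖ := norm_pos_iff.mpr ha
  have hrw : 0 < ‖w‖ := norm_pos_iff.mpr hw
  have h1 := norm_thetaDivFactor_mul_le hp0 hp1 n ha
  have h2 := norm_thetaDivPhi_mul_le hp0 hp1 (n - 1) hw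
  have hk : 0 < p ^ n := zpow_pos hp0 n
  rw [zpow_sub_one₀ hp0.ne'] at h2
  have e : ‖bilateralTerm p n a w‖ =
      p ^ n * ‖a‖ * ‖thetaDivFactor p n a‖ * ‖thetaDivPhi p (n - 1) w‖ := by
    simp [bilateralTerm, abs_of_pos hp0]
  rw [e]
  set A := ‖thetaDivFactor p n a‖
  set G := ‖thetaDivPhi p (n - 1) w‖
  set Pa := ‖thetaProd p (‖a‖ : ℝ)‖
  set Pw := ‖thetaProd p (‖w‖ : ℝ)‖
  have hA : 0 ≤ A := norm_nonneg _
  have hG : 0 ≤ G := norm_nonneg _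
  have hPa : 0 ≤ Pa := norm_nonneg _
  have hPw : 0 ≤ Pw := norm_nonneg _
  have hA1 : 0 ≤ A * (p ^ n * ‖a‖) := by positivity
  have hG1 : 0 ≤ G * (p ^ n * p⁻¹ * ‖w‖) := by positivity
  rcases le_total 0 n with hn | hn
  · rw [← zpow_eq_pow_natAbs hn]
    calc p ^ n * ‖a‖ * A * G ≤ p ^ n * ‖a‖ * Pa * Pw := by
          gcongr
          · linarith
          · linarith
      _ = Pa * Pw * ‖a‖ * p ^ n := by ring
      _ ≤ Pa * Pw * (‖a‖ + p * ‖w‖⁻¹) * p ^ n := by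
        gcongr
        exact le_add_of_nonneg_right (by positivity)
  · rw [← zpow_eq_inv_pow_natAbs hn]
    calc p ^ n * ‖a‖ * A * G
        = (A * (p ^ n * ‖a‖)) * (G * (p ^ n * p⁻¹ * ‖w‖)) * (p * ‖w‖⁻¹ * (p ^ n)⁻¹) := by
          field_simp
      _ ≤ Pa * Pw * (p * ‖w‖⁻¹ * (p ^ n)⁻¹) := by
          gcongr
          · linarith
          · linarith
      _ = Pa * Pw * (p * ‖w‖⁻¹) * (p ^ n)⁻¹ := by ring
      _ ≤ Pa * Pw * (‖a‖ + p * ‖w‖⁻¹) * (p ^ n)⁻¹ := by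
        gcongr
        exact le_add_of_nonneg_left (by positivity)

lemma summable_bilateralTerm {a w : ℂ} (ha : a ≠ 0) (hw : w ≠ 0) :
    Summable fun n : ℤ => bilateralTerm p n a w :=
  ((summable_pow_natAbs hp0 hp1).mul_left _).of_norm_bounded
    fun n => norm_bilateralTerm_le hp0 hp1 n ha hw

/-- Two substitutions are needed: `(z, t z)` for the functional equation, and a constant with `λ/z`
for continuity in `x`. -/
lemma differentiableOn_regularSum {α ω : ℂ → ℂ} (hα : DifferentiableOn ℂ α {0}ᶜ)
    (hω : DifferentiableOn ℂ ω {0}ᶜ) (hα0 : ∀ z, z ≠ 0 → α z ≠ 0) (hω0 : ∀ z, z ≠ 0 → ω z ≠ 0) :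
    DifferentiableOn ℂ (fun z => regularSum p (α z) (ω z)) {0}ᶜ := by
  refine differentiableOn_tsum_of_locally_bounded
    (F := fun n z => bilateralTerm p n (α z) (ω z)) (M := fun z => ‖thetaProd p (‖α z‖ : ℝ)‖ *
      ‖thetaProd p (‖ω z‖ : ℝ)‖ * (‖α z‖ + p * ‖ω z‖⁻¹)) (fun n => ?_) ?_
    (summable_pow_natAbs hp0 hp1) (fun n => by positivity)
    (fun n z hz => norm_bilateralTerm_le hp0 hp1 n (hα0 z hz) (hω0 z hz))
  · exact ((hα.const_mul _).mul ((differentiableOn_thetaDivFactor hp0 hp1 n).comp hα hα0)).mul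
      ((differentiableOn_thetaDivPhi hp0 hp1 (n - 1)).comp hω hω0)
  · have hαc := hα.continuousOn
    have hωc := hω.continuousOn
    refine ((continuousOn_norm_thetaProd_norm hp0 hp1 hαc hα0).mul
      (continuousOn_norm_thetaProd_norm hp0 hp1 hωc hω0)).mul
      (hαc.norm.add (continuousOn_const.mul (hωc.norm.inv₀ fun z hz => ?_)))
    simpa using hω0 z hz

omit hp1 in
lemma regularSum_eq_mul {a w : ℂ} (ha : a ≠ 0) (hw : w ≠ 0) :
    regularSum p a w = a * w * regularSum p (p * a) (p * w) := by
  have hpc : (p : ℂ) ≠ 0 := by exact_mod_cast hp0.ne'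
  unfold regularSum
  rw [← tsum_mul_left, ← (Equiv.addRight (1 : ℤ)).tsum_eq]
  congr 1
  ext n
  rw [Equiv.coe_addRight, bilateralTerm, bilateralTerm, thetaDivFactor_mul_left hp0 n ha,
    show n + 1 - 1 = (n - 1) + 1 by ring, thetaDivPhi_mul_left hp0 (n - 1) hw, zpow_add_one₀ hpc]
  ring

/-- Because `thetaProd p (-1) = 0`, dividing by `1 - p^n` leaves something nonzero only if `p^n =
1`, that is `n = 0`. -/
lemma regularSum_neg_one (w : ℂ) :
    regularSum p (-1) w = -(phi p (-p) ^ 2 * (p / w) * phi p (p ^ 2 / w)) := by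
  have hpc : (p : ℂ) ≠ 0 := by exact_mod_cast hp0.ne'
  unfold regularSum
  rw [tsum_eq_single 0]
  · have e : (p : ℂ) / ((p : ℂ)⁻¹ * w) = p ^ 2 / w := by
      rw [← div_div, div_inv_eq_mul, sq]
    have e1 : thetaDivFactor p 0 (-1) = phi p (-p) ^ 2 := by
      simp [thetaDivFactor, thetaDivPhi, sq, div_neg]
    have e2 : thetaDivPhi p (-1) w = p / w * phi p (p ^ 2 / w) := by
      simp [thetaDivPhi, e, div_eq_mul_inv]
    rw [bilateralTerm, e1, zero_sub, e2, zpow_zero]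
    ring
  · intro n hn
    have h := thetaDivFactor_mul hp0 hp1 n (neg_ne_zero.mpr (one_ne_zero (α := ℂ)))
    rw [thetaProd_neg_one hp0 hp1] at h
    have hne : (1 : ℂ) + (p : ℂ) ^ n * (-1) ≠ 0 := by
      intro h0
      have h1 : p ^ n = 1 := by
        have : ((p ^ n : ℝ) : ℂ) = 1 := by push_cast; linear_combination -h0
        exact_mod_cast this
      exact hn ((zpow_eq_one_iff_right₀ hp0.le hp1.ne).mp h1)
    simp [bilateralTerm, (mul_eq_zero.mp h).resolve_right hne]

lemma bilateralTerm_eq (n : ℤ) {a w : ℂ} (ha : a ≠ 0) (hw : w ≠ 0) (hPa : thetaProd p a ≠ 0)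
    (hPw : thetaProd p w ≠ 0) :
    bilateralTerm p n a w = thetaProd p a * thetaProd p w *
      ((p : ℂ) ^ n * a / ((1 + (p : ℂ) ^ n * a) * phi p ((p : ℂ) ^ (n - 1) * w))) := by
  have h1 := thetaDivFactor_mul hp0 hp1 n ha
  have h2 := thetaDivPhi_mul hp0 hp1 (n - 1) hw
  have h3 : 1 + (p : ℂ) ^ n * a ≠ 0 := fun h => hPa (by rw [← h1, h, mul_zero])
  have h4 : phi p ((p : ℂ) ^ (n - 1) * w) ≠ 0 := fun h => hPw (by rw [← h2, h, mul_zero])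
  rw [← h1, ← h2, bilateralTerm]
  field_simp

lemma summable_bilateralSum {a w : ℂ} (ha : a ≠ 0) (hw : w ≠ 0) (hPa : thetaProd p a ≠ 0)
    (hPw : thetaProd p w ≠ 0) :
    Summable fun n : ℤ =>
      (p : ℂ) ^ n * a / ((1 + (p : ℂ) ^ n * a) * phi p ((p : ℂ) ^ (n - 1) * w)) := by
  have h := summable_bilateralTerm hp0 hp1 ha hw
  simp only [bilateralTerm_eq hp0 hp1 _ ha hw hPa hPw] at h
  exact (summable_mul_left_iff (mul_ne_zero hPa hPw)).mp h

lemma regularSum_eq {a w : ℂ} (ha : a ≠ 0) (hw : w ≠ 0) (hPa : thetaProd p a ≠ 0)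
    (hPw : thetaProd p w ≠ 0) :
    regularSum p a w = thetaProd p a * thetaProd p w * bilateralSum p a w := by
  unfold regularSum bilateralSum
  simp only [bilateralTerm_eq hp0 hp1 _ ha hw hPa hPw, tsum_mul_left]

end

/-! ### The connection formula for the bilateral sum -/

section

variable {p : ℝ} (hp0 : 0 < p) (hp1 : p < 1)

include hp0 hp1

lemma isQuasiPeriodic_thetaProd_mul_thetaProd {t α β : ℂ} (hα : α ≠ 0) (hβ : β ≠ 0)
    (ht : α * β = t) :
    IsQuasiPeriodic p t 2 (fun z => thetaProd p (α * z) * thetaProd p (β * z)) := by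
  have key : ∀ {γ : ℂ}, γ ≠ 0 → DifferentiableOn ℂ (fun z => thetaProd p (γ * z)) {0}ᶜ :=
    fun {γ} hγ => (differentiableOn_thetaProd hp0 hp1).comp (f := fun z => γ * z) (by fun_prop)
      (fun z hz => mul_ne_zero hγ hz)
  refine ⟨(key hα).mul (key hβ), fun z hz => ?_⟩
  rw [thetaProd_eq_mul hp0 hp1 (mul_ne_zero hα hz), thetaProd_eq_mul hp0 hp1 (mul_ne_zero hβ hz),
    mul_left_comm (p : ℂ) α z, mul_left_comm (p : ℂ) β z, ← ht]
  ring

lemma isQuasiPeriodic_regularSum {t : ℂ} (ht : t ≠ 0) :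
    IsQuasiPeriodic p t 2 (fun z => regularSum p z (t * z)) := by
  refine ⟨differentiableOn_regularSum hp0 hp1 (by fun_prop) (by fun_prop) (fun z hz => hz)
    (fun z hz => mul_ne_zero ht hz), fun z hz => ?_⟩
  rw [regularSum_eq_mul hp0 hz (mul_ne_zero ht hz), mul_left_comm (p : ℂ) t z]
  ring

/-- The factor `phi p (-(t / p))` completes the surviving term to a theta product. It equals
`e_q(-q/x)` and is the source of the denominator in the theorem. -/
lemma phi_mul_regularSum_neg_one {t : ℂ} (ht : t ≠ 0) :
    phi p (-(t / p)) * regularSum p (-1) (-t) = -(phi p (-p) ^ 2 * thetaProd p (-t)) := by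
  have hpc : (p : ℂ) ≠ 0 := by exact_mod_cast hp0.ne'
  rw [regularSum_neg_one hp0 hp1, thetaProd, phi_eq_mul hp0 hp1 (-(t / p)),
    phi_eq_mul hp0 hp1 (p / (-t)), show (p : ℂ) * -(t / p) = -t by field_simp,
    show (p : ℂ) * (p / -t) = p ^ 2 / -t by ring]
  field_simp
  ring

/-- The difference of two bilateral sums as a quotient of theta products. -/
theorem bilateralSum_sub {a b t : ℂ} (ha : a ≠ 0) (hb : b ≠ 0) (ht : t ≠ 0)
    (hPa : thetaProd p a ≠ 0) (hPb : thetaProd p b ≠ 0)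
    (hPat : thetaProd p (t * a) ≠ 0) (hPbt : thetaProd p (t * b) ≠ 0) :
    phi p (-(t / p)) * (bilateralSum p a (t * a) - bilateralSum p b (t * b)) *
      (thetaProd p a * thetaProd p (p * b) * thetaProd p (t * a) * thetaProd p (t * b)) =
    -phi p (-p) ^ 2 * (thetaProd p (-(a / b)) * thetaProd p (-t) * thetaProd p (-(t * a * b))) := by
  have hPb' : thetaProd p (p * b) ≠ 0 := fun h =>
    hPb (by rw [thetaProd_eq_mul hp0 hp1 hb, h, mul_zero])
  set E := phi p (-(t / p)) with hE
  set N := thetaProd p (p * b) * thetaProd p (t * b) with hN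
  set S := bilateralSum p b (t * b) with hS
  set f1 : ℂ → ℂ := fun z => thetaProd p (1 * z) * thetaProd p (t * z) with hf1
  set f2 : ℂ → ℂ := fun z => thetaProd p (-b⁻¹ * z) * thetaProd p (-(t * b) * z) with hf2
  set f3 : ℂ → ℂ := fun z => regularSum p z (t * z) with hf3
  -- The third function is the claimed identity with `a` replaced by `z`, and it vanishes at both
  -- `b` and `-1`. Evaluating there gives `c 0 = c 1 = 0`, so it vanishes identically; independence
  -- of `f1` and `f2` need not be shown separately.
  obtain ⟨c, hc, hrel⟩ := exists_relation_of_isQuasiPeriodic hp0 ht two_pos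
    ![f1, f2, fun z => E * N * (f3 z - S * f1 z) + phi p (-p) ^ 2 * thetaProd p (-t) * f2 z] (by
      have h1 : IsQuasiPeriodic p t 2 f1 := isQuasiPeriodic_thetaProd_mul_thetaProd hp0 hp1
        one_ne_zero ht (one_mul t)
      have h2 : IsQuasiPeriodic p t 2 f2 := isQuasiPeriodic_thetaProd_mul_thetaProd hp0 hp1
        (neg_ne_zero.mpr (inv_ne_zero hb)) (neg_ne_zero.mpr (mul_ne_zero ht hb)) (by field_simp)
      have h3 : IsQuasiPeriodic p t 2 f3 := isQuasiPeriodic_regularSum hp0 hp1 ht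
      have h4 : IsQuasiPeriodic p t 2 (fun z => E * N * (f3 z - S * f1 z) +
          phi p (-p) ^ 2 * thetaProd p (-t) * f2 z) := by
        refine ⟨((h3.diff.sub (h1.diff.const_mul S)).const_mul (E * N)).add
          (h2.diff.const_mul _), fun z hz => ?_⟩
        rw [h1.eq z hz, h2.eq z hz, h3.eq z hz]
        ring
      intro i
      fin_cases i
      · exact h1
      · exact h2
      · exact h4)
  replace hrel : ∀ z, z ≠ 0 → c 0 * f1 z + c 1 * f2 z + c 2 * (E * N * (f3 z - S * f1 z) +
      phi p (-p) ^ 2 * thetaProd p (-t) * f2 z) = 0 := fun z hz => by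
    simpa [Fin.sum_univ_succ, add_assoc] using hrel z hz
  have hz0 := thetaProd_neg_one hp0 hp1
  have f1b : f1 b ≠ 0 := by simpa [hf1] using ⟨hPb, hPbt⟩
  have f2b : f2 b = 0 := by simp [hf2, hb, hz0]
  have f3b : f3 b = S * f1 b := by
    simp only [hf3, hf1, hS, one_mul]
    rw [regularSum_eq hp0 hp1 hb (mul_ne_zero ht hb) hPb hPbt]
    ring
  have f1n : f1 (-1) = 0 := by simp [hf1, hz0]
  have f2n : f2 (-1) = N := by
    simp [hf2, hN, thetaProd_mul_eq_inv hp0 b]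
  have f3n : E * f3 (-1) = -(phi p (-p) ^ 2 * thetaProd p (-t)) := by
    simp only [hf3, mul_neg, mul_one]
    exact phi_mul_regularSum_neg_one hp0 hp1 ht
  have hc0 : c 0 = 0 := by
    have := hrel b hb
    rw [f2b, f3b] at this
    simpa [f1b] using this
  have hNne : N ≠ 0 := mul_ne_zero hPb' hPbt
  have hc1 : c 1 = 0 := by
    have := hrel (-1) (by simp)
    rw [f1n, f2n, hc0] at this
    have h : c 1 * N = 0 := by linear_combination this - c 2 * N * f3n
    exact (mul_eq_zero.mp h).resolve_right hNne
  have hc2 : c 2 ≠ 0 := by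
    intro h
    apply hc
    ext i
    fin_cases i
    · exact hc0
    · exact hc1
    · exact h
  have key := hrel a ha
  rw [hc0, hc1, zero_mul, zero_mul, zero_add, zero_add] at key
  replace key := (mul_eq_zero.mp key).resolve_left hc2
  simp only [hf1, hf2, hf3, one_mul] at key
  rw [regularSum_eq hp0 hp1 ha (mul_ne_zero ht ha) hPa hPat,
    show -b⁻¹ * a = -(a / b) by ring, show -(t * b) * a = -(t * a * b) by ring] at key
  rw [hN] at key
  linear_combination key

end

/-! ### The Jackson integral along a spiral -/

/-- The tail from `k` is the full sum cut off by an indicator; dominated convergence applies. -/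
lemma tendsto_tsum_nat_add_atBot {u : ℤ → ℂ} (hu : Summable u) :
    Tendsto (fun k : ℤ => ∑' m : ℕ, u (m + k)) atBot (𝓝 (∑' n, u n)) := by
  have h : ∀ k : ℤ, ∑' m : ℕ, u (m + k) = ∑' n, (Set.Ici k).indicator u n := by
    intro k
    have hinj : Function.Injective fun m : ℕ => (m : ℤ) + k := fun m n h => by simpa using h
    rw [← hinj.tsum_eq]
    · exact tsum_congr fun m => by simp
    · intro n hn
      have hn' : k ≤ n := by
        by_contra h
        exact hn (Set.indicator_of_notMem (s := Set.Ici k) h u)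
      exact ⟨(n - k).toNat, by simp only; omega⟩
  simp only [h]
  refine tendsto_tsum_of_dominated_convergence hu.norm (fun n => ?_)
    (Eventually.of_forall fun k n => norm_indicator_le_norm_self u n)
  refine tendsto_const_nhds.congr' ?_
  filter_upwards [eventually_le_atBot n] with k hk
  simp [hk]

section

variable {q : ℝ} (hq : 1 < q)

lemma qExp_eq (q : ℝ) (z : ℂ) : qExp q z = phi q⁻¹ ((1 - (q : ℂ)⁻¹) * z) := by
  unfold qExp phi
  push_cast
  congr 1
  ext k
  ring

include hq

lemma ofReal_ne_zero_of_one_lt : (q : ℂ) ≠ 0 := by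
  exact_mod_cast (zero_lt_one.trans hq).ne'

lemma one_sub_inv_ne_zero_of_one_lt : 1 - (q : ℂ)⁻¹ ≠ 0 := by
  rw [sub_ne_zero, ne_comm, Ne, inv_eq_one]
  exact_mod_cast hq.ne'

/-- The factor `q` in the argument of `e_q` lowers the exponent to `n - 1`; the factor `1 - p` on
the right comes from `λ = (1-p) a`. -/
lemma integrand_eq {lam x : ℂ} (hlam : lam ≠ 0) (n : ℤ) :
    integrand q x (((q⁻¹ : ℝ) : ℂ) ^ n * lam) * ((q⁻¹ : ℝ) : ℂ) ^ n * lam =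
      (1 - (q : ℂ)⁻¹) * (((q⁻¹ : ℝ) : ℂ) ^ n * (lam / (1 - (q : ℂ)⁻¹)) /
        ((1 + ((q⁻¹ : ℝ) : ℂ) ^ n * (lam / (1 - (q : ℂ)⁻¹))) *
          phi q⁻¹ (((q⁻¹ : ℝ) : ℂ) ^ (n - 1) * (lam / x)))) := by
  have hq0 := ofReal_ne_zero_of_one_lt hq
  have hc := one_sub_inv_ne_zero_of_one_lt hq
  have hp : ((q⁻¹ : ℝ) : ℂ) ≠ 0 := by push_cast; exact inv_ne_zero hq0
  have e : (1 - (q : ℂ)⁻¹) * (q * (((q⁻¹ : ℝ) : ℂ) ^ n * lam / ((1 - (q : ℂ)⁻¹) * x))) =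
      ((q⁻¹ : ℝ) : ℂ) ^ (n - 1) * (lam / x) := by
    rw [zpow_sub_one₀ hp]
    push_cast
    rw [inv_inv]
    generalize 1 - (q : ℂ)⁻¹ = d at hc
    field_simp
  unfold integrand psi
  rw [qExp_eq, e, mul_div_assoc]
  generalize phi q⁻¹ (((q⁻¹ : ℝ) : ℂ) ^ (n - 1) * (lam / x)) = A
  generalize ((q⁻¹ : ℝ) : ℂ) ^ n = B
  have h : (1 - (q : ℂ)⁻¹) * (lam / (1 - (q : ℂ)⁻¹)) = lam := mul_div_cancel₀ lam hc
  generalize lam / (1 - (q : ℂ)⁻¹) = D at *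
  rw [← h, ← div_div]
  ring

lemma hasSpiralIntegral_integrand {lam x : ℂ} (hlam : lam ≠ 0) (hx : x ≠ 0)
    (h1 : thetaProd q⁻¹ (lam / (1 - (q : ℂ)⁻¹)) ≠ 0) (h2 : thetaProd q⁻¹ (lam / x) ≠ 0) :
    HasSpiralIntegral q⁻¹ (integrand q x) lam ((1 - (q : ℂ)⁻¹) ^ 2 *
      bilateralSum q⁻¹ (lam / (1 - (q : ℂ)⁻¹)) (lam / x)) := by
  have hc := one_sub_inv_ne_zero_of_one_lt hq
  have hp0 : 0 < q⁻¹ := inv_pos.mpr (zero_lt_one.trans hq)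
  have hp1 : q⁻¹ < 1 := inv_lt_one_of_one_lt₀ hq
  have hp : ((q⁻¹ : ℝ) : ℂ) ≠ 0 := by exact_mod_cast hp0.ne'
  have hs := summable_bilateralSum hp0 hp1 (div_ne_zero hlam hc) (div_ne_zero hlam hx) h1 h2
  set u : ℤ → ℂ := fun n => ((q⁻¹ : ℝ) : ℂ) ^ n * (lam / (1 - (q : ℂ)⁻¹)) /
        ((1 + ((q⁻¹ : ℝ) : ℂ) ^ n * (lam / (1 - (q : ℂ)⁻¹))) *
          phi q⁻¹ (((q⁻¹ : ℝ) : ℂ) ^ (n - 1) * (lam / x))) with hu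
  have hterm : ∀ (k : ℤ) (m : ℕ),
      integrand q x (((q⁻¹ : ℝ) : ℂ) ^ m * (((q⁻¹ : ℝ) : ℂ) ^ k * lam)) * ((q⁻¹ : ℝ) : ℂ) ^ m =
        (1 - (q : ℂ)⁻¹) / (((q⁻¹ : ℝ) : ℂ) ^ k * lam) * u (m + k) := by
    intro k m
    have h := integrand_eq hq (x := x) hlam (m + k)
    have hk : ((q⁻¹ : ℝ) : ℂ) ^ k * lam ≠ 0 := mul_ne_zero (zpow_ne_zero k hp) hlam
    rw [div_mul_eq_mul_div, eq_div_iff hk, hu]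
    simp only
    rw [← h, zpow_add₀ hp, zpow_natCast, mul_assoc (_ ^ m) (_ ^ k) lam]
    ring
  constructor
  · intro k
    unfold JacksonSummable
    simp only [hterm]
    exact (hs.comp_injective (i := fun m : ℕ => (m : ℤ) + k)
      (fun m n h => by simpa using h)).mul_left _
  · have h := (tendsto_tsum_nat_add_atBot hs).const_mul ((1 - (q : ℂ)⁻¹) ^ 2)
    -- The endpoint `y = p^k λ` cancels. One factor `1 - p` comes from the Jackson integral, the
    -- other from `integrand_eq`.
    refine h.congr fun k => ?_
    unfold jacksonIntegral
    simp only [hterm]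
    rw [tsum_mul_left]
    have hk : ((q⁻¹ : ℝ) : ℂ) ^ k * lam ≠ 0 := mul_ne_zero (zpow_ne_zero k hp) hlam
    generalize ((q⁻¹ : ℝ) : ℂ) ^ k * lam = y at hk
    push_cast
    field_simp

lemma discreteSum_eq {lam x : ℂ} (hlam : lam ≠ 0) (hx : x ≠ 0)
    (h1 : thetaProd q⁻¹ (lam / (1 - (q : ℂ)⁻¹)) ≠ 0) (h2 : thetaProd q⁻¹ (lam / x) ≠ 0) :
    discreteSum q lam x = q * (1 - (q : ℂ)⁻¹) *
      bilateralSum q⁻¹ (lam / (1 - (q : ℂ)⁻¹)) (lam / x) := by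
  have hc := one_sub_inv_ne_zero_of_one_lt hq
  have h : spiralIntegral q⁻¹ (integrand q x) lam = _ :=
    (hasSpiralIntegral_integrand hq hlam hx h1 h2).2.limUnder_eq
  rw [discreteSum, h]
  field_simp

/-! ### Dependence on `x`: nonvanishing, continuity, isolated zeros of the denominator. -/

lemma thetaProd_div_ne_zero {lam x : ℂ} (hlam : lam ≠ 0) (hx : x ≠ 0)
    (h : ∀ n : ℤ, x ≠ -(lam * (q : ℂ) ^ n)) : thetaProd q⁻¹ (lam / x) ≠ 0 := by
  have hp0 : 0 < q⁻¹ := inv_pos.mpr (zero_lt_one.trans hq)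
  refine thetaProd_ne_zero hp0 (inv_lt_one_of_one_lt₀ hq) (div_ne_zero hlam hx) fun n hn =>
    h (-n) ?_
  push_cast at hn
  rw [inv_zpow'] at hn
  field_simp at hn
  linear_combination hn

/-- Near a point where it is defined, the discrete `q`-Borel sum is continuous in `x`. -/
lemma continuousAt_discreteSum {lam x : ℂ} (hlam : lam ≠ 0) (hx : x ≠ 0)
    (h1 : thetaProd q⁻¹ (lam / (1 - (q : ℂ)⁻¹)) ≠ 0) (h2 : thetaProd q⁻¹ (lam / x) ≠ 0) :
    (∀ᶠ z in 𝓝 x, z ≠ 0 ∧ thetaProd q⁻¹ (lam / z) ≠ 0) ∧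
      ContinuousAt (discreteSum q lam) x := by
  have hc := one_sub_inv_ne_zero_of_one_lt hq
  have hp0 : 0 < q⁻¹ := inv_pos.mpr (zero_lt_one.trans hq)
  have hp1 : q⁻¹ < 1 := inv_lt_one_of_one_lt₀ hq
  have hdiv : DifferentiableOn ℂ (fun z : ℂ => lam / z) {0}ᶜ :=
    (differentiableOn_const lam).div differentiableOn_id fun z hz => hz
  have hmem : ({0}ᶜ : Set ℂ) ∈ 𝓝 x := isOpen_compl_singleton.mem_nhds hx
  have hP : ContinuousAt (fun z => thetaProd q⁻¹ (lam / z)) x :=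
    (((differentiableOn_thetaProd hp0 hp1).comp hdiv
      fun z hz => div_ne_zero hlam hz).differentiableAt hmem).continuousAt
  have hR : ContinuousAt (fun z => regularSum q⁻¹ (lam / (1 - (q : ℂ)⁻¹)) (lam / z)) x :=
    ((differentiableOn_regularSum hp0 hp1 (α := fun _ => lam / (1 - (q : ℂ)⁻¹))
      (differentiableOn_const _) hdiv (fun _ _ => div_ne_zero hlam hc)
      fun z hz => div_ne_zero hlam hz).differentiableAt hmem).continuousAt
  have hev : ∀ᶠ z in 𝓝 x, z ≠ 0 ∧ thetaProd q⁻¹ (lam / z) ≠ 0 :=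
    (eventually_ne_nhds hx).and (hP.eventually_ne h2)
  refine ⟨hev, ?_⟩
  have hcont : ContinuousAt (fun z => q * (1 - (q : ℂ)⁻¹) *
      (regularSum q⁻¹ (lam / (1 - (q : ℂ)⁻¹)) (lam / z) /
        (thetaProd q⁻¹ (lam / (1 - (q : ℂ)⁻¹)) * thetaProd q⁻¹ (lam / z)))) x :=
    (hR.div (continuousAt_const.mul hP) (mul_ne_zero h1 h2)).const_mul _
  refine hcont.congr ?_
  filter_upwards [hev] with z hz
  rw [discreteSum_eq hq hlam hz.1 h1 hz.2,
    regularSum_eq hp0 hp1 (div_ne_zero hlam hc) (div_ne_zero hlam hz.1) h1 hz.2,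
    mul_div_cancel_left₀ _ (mul_ne_zero h1 hz.2)]

lemma eventually_qExp_ne_zero {x : ℂ} (hx : x ≠ 0) :
    ∀ᶠ z in 𝓝[≠] x, qExp q (-(q / z)) ≠ 0 := by
  have hq0 := ofReal_ne_zero_of_one_lt hq
  have hp0 : 0 < q⁻¹ := inv_pos.mpr (zero_lt_one.trans hq)
  have hp1 : q⁻¹ < 1 := inv_lt_one_of_one_lt₀ hq
  have hd : Differentiable ℂ (qExp q) := by
    rw [show qExp q = fun z => phi q⁻¹ ((1 - (q : ℂ)⁻¹) * z) from funext (qExp_eq q)]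
    exact (differentiable_phi hp0 hp1).comp (by fun_prop)
  have han : AnalyticOnNhd ℂ (qExp q) Set.univ := hd.differentiableOn.analyticOnNhd isOpen_univ
  have hne : ∀ᶠ w in 𝓝[≠] (-(q / x)), qExp q w ≠ 0 := by
    -- Otherwise the identity theorem would give `e_q = 0` everywhere, against `e_q(0) = 1`.
    refine (han _ (Set.mem_univ _)).eventually_eq_zero_or_eventually_ne_zero.resolve_left fun h => ?_
    have h0 := han.eqOn_zero_of_preconnected_of_eventuallyEq_zero isPreconnected_univ
      (Set.mem_univ _) h (Set.mem_univ 0)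
    simp [qExp_eq, phi_zero] at h0
  suffices h : Tendsto (fun z : ℂ => -(q / z)) (𝓝[≠] x) (𝓝[≠] (-(q / x))) from h.eventually hne
  refine tendsto_nhdsWithin_iff.mpr ⟨?_, ?_⟩
  · have : ContinuousAt (fun z : ℂ => -(q / z)) x := (continuousAt_const.div continuousAt_id hx).neg
    exact this.tendsto.mono_left nhdsWithin_le_nhds
  · filter_upwards [self_mem_nhdsWithin] with z hz h
    apply hz
    have h' : (q : ℂ) / z = q / x := neg_injective h
    simpa [div_eq_mul_inv, hq0] using h'

end

/-- The connection formula with the constant made explicit. -/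
theorem discreteSum_sub_eq {q : ℝ} (hq : 1 < q) {κ : ℂ} (hκ0 : κ ≠ 0)
    (hκ : ∀ z, z ≠ 0 → theta q⁻¹ z = κ * thetaProd q⁻¹ z) {lam mu x : ℂ}
    (hlam : lam ≠ 0) (hmu : mu ≠ 0) (hx : x ≠ 0)
    (h1 : thetaProd q⁻¹ (lam / (1 - (q : ℂ)⁻¹)) ≠ 0)
    (h2 : thetaProd q⁻¹ (mu / (1 - (q : ℂ)⁻¹)) ≠ 0)
    (h3 : thetaProd q⁻¹ (lam / x) ≠ 0) (h4 : thetaProd q⁻¹ (mu / x) ≠ 0)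
    (hE : qExp q (-(q / x)) ≠ 0) :
    discreteSum q lam x - discreteSum q mu x =
      -(κ * (q * (1 - (q : ℂ)⁻¹)) * phi q⁻¹ (-(q : ℂ)⁻¹) ^ 2) *
        thetaQuotient q (lam / (1 - (q : ℂ)⁻¹)) (mu / (1 - (q : ℂ)⁻¹)) x /
          qExp q (-(q / x)) := by
  have hq0 := ofReal_ne_zero_of_one_lt hq
  have hc := one_sub_inv_ne_zero_of_one_lt hq
  have hp0 : 0 < q⁻¹ := inv_pos.mpr (zero_lt_one.trans hq)
  have hp1 : q⁻¹ < 1 := inv_lt_one_of_one_lt₀ hq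
  rw [discreteSum_eq hq hlam hx h1 h3, discreteSum_eq hq hmu hx h2 h4]
  have ha := div_ne_zero hlam hc
  have hb := div_ne_zero hmu hc
  have ht := div_ne_zero hc hx
  have el : lam / x = (1 - (q : ℂ)⁻¹) / x * (lam / (1 - (q : ℂ)⁻¹)) := by
    rw [div_mul_div_comm, mul_comm x, mul_div_mul_left _ _ hc]
  have em : mu / x = (1 - (q : ℂ)⁻¹) / x * (mu / (1 - (q : ℂ)⁻¹)) := by
    rw [div_mul_div_comm, mul_comm x, mul_div_mul_left _ _ hc]
  have eE : qExp q (-(q / x)) = phi q⁻¹ (-((1 - (q : ℂ)⁻¹) / x / (q⁻¹ : ℝ))) := by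
    rw [qExp_eq]
    congr 1
    push_cast
    field_simp
  rw [eE] at hE ⊢
  rw [el] at h3 ⊢
  rw [em] at h4 ⊢
  unfold thetaQuotient
  generalize lam / (1 - (q : ℂ)⁻¹) = a at *
  generalize mu / (1 - (q : ℂ)⁻¹) = b at *
  rw [mul_div_right_comm _ a x, mul_assoc _ a b, mul_div_right_comm _ (a * b) x,
    mul_div_right_comm _ b x]
  generalize (1 - (q : ℂ)⁻¹) / x = t at *
  have hpb : thetaProd q⁻¹ ((q : ℂ)⁻¹ * b) ≠ 0 := fun h => h2 (by
    rw [thetaProd_eq_mul hp0 hp1 hb, Complex.ofReal_inv, h, mul_zero])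
  have key := bilateralSum_sub hp0 hp1 ha hb ht h1 h2 h3 h4
  rw [hκ _ (neg_ne_zero.mpr (div_ne_zero ha hb)), hκ _ (neg_ne_zero.mpr ht),
    hκ _ (neg_ne_zero.mpr (mul_ne_zero ht (mul_ne_zero ha hb))), hκ _ ha,
    hκ _ (mul_ne_zero (inv_ne_zero hq0) hb), hκ _ (mul_ne_zero ht ha), hκ _ (mul_ne_zero ht hb)]
  rw [Complex.ofReal_inv, mul_assoc t a b] at key
  rw [Complex.ofReal_inv] at hE ⊢
  generalize phi q⁻¹ (-(t / (q : ℂ)⁻¹)) = E at *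
  generalize bilateralSum q⁻¹ a (t * a) = Sa at *
  generalize bilateralSum q⁻¹ b (t * b) = Sb at *
  generalize phi q⁻¹ (-(q : ℂ)⁻¹) = F at *
  generalize 1 - (q : ℂ)⁻¹ = d at *
  rw [eq_div_iff hE, mul_div_assoc', eq_div_iff (by simp [*])]
  -- The theta quotient has three thetas above and four below; the single `κ` in the constant
  -- restores the balance.
  linear_combination (q * d * κ ^ 4) * key

end QEuler

end

theorem mainTheorem10 (q : ℝ) (hq : 1 < q) :
    ∃ C : ℂ, ∀ lam mu : ℂ, lam ≠ 0 → mu ≠ 0 →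
      (∀ n : ℤ, lam ≠ -((1 - (q : ℂ)⁻¹) * (q : ℂ) ^ n)) →
      (∀ n : ℤ, mu ≠ -((1 - (q : ℂ)⁻¹) * (q : ℂ) ^ n)) →
      ∀ x : ℂ, x ≠ 0 →
        (∀ n : ℤ, x ≠ -(lam * (q : ℂ) ^ n)) → (∀ n : ℤ, x ≠ -(mu * (q : ℂ) ^ n)) →
        QEuler.DiscreteSumConverges q lam x ∧ QEuler.DiscreteSumConverges q mu x ∧
        (QEuler.qExp q (-(q / x)) ≠ 0 →
          QEuler.discreteSum q lam x - QEuler.discreteSum q mu x =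
            C * QEuler.thetaQuotient q (lam / (1 - (q : ℂ)⁻¹)) (mu / (1 - (q : ℂ)⁻¹)) x /
              QEuler.qExp q (-(q / x))) ∧
        Filter.Tendsto
          (fun z : ℂ =>
            C * QEuler.thetaQuotient q (lam / (1 - (q : ℂ)⁻¹)) (mu / (1 - (q : ℂ)⁻¹)) z /
              QEuler.qExp q (-(q / z)))
          (nhdsWithin x {x}ᶜ)
          (nhds (QEuler.discreteSum q lam x - QEuler.discreteSum q mu x)) := by
  have hq0 := QEuler.ofReal_ne_zero_of_one_lt hq
  have hc := QEuler.one_sub_inv_ne_zero_of_one_lt hq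
  obtain ⟨κ, hκ0, hκ⟩ := QEuler.exists_theta_eq (inv_pos.mpr (zero_lt_one.trans hq))
    (inv_lt_one_of_one_lt₀ hq)
  have hspiral : ∀ l : ℂ, l ≠ 0 → (∀ n : ℤ, l ≠ -((1 - (q : ℂ)⁻¹) * (q : ℂ) ^ n)) →
      QEuler.thetaProd q⁻¹ (l / (1 - (q : ℂ)⁻¹)) ≠ 0 := by
    intro l hl h
    -- The spiral condition is the pole condition with `x` replaced by `1 - p`, after `n ↦ -n`.
    refine QEuler.thetaProd_div_ne_zero hq hl hc fun n hn => h (-n) ?_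
    have hqn : (q : ℂ) ^ n ≠ 0 := zpow_ne_zero n hq0
    rw [hn, zpow_neg]
    field_simp
  refine ⟨-(κ * (q * (1 - (q : ℂ)⁻¹)) * QEuler.phi q⁻¹ (-(q : ℂ)⁻¹) ^ 2),
    fun lam mu hlam hmu hl hm x hx hxl hxm => ?_⟩
  have h1 := hspiral lam hlam hl
  have h2 := hspiral mu hmu hm
  have h3 := QEuler.thetaProd_div_ne_zero hq hlam hx hxl
  have h4 := QEuler.thetaProd_div_ne_zero hq hmu hx hxm
  refine ⟨⟨_, QEuler.hasSpiralIntegral_integrand hq hlam hx h1 h3⟩,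
    ⟨_, QEuler.hasSpiralIntegral_integrand hq hmu hx h2 h4⟩,
    QEuler.discreteSum_sub_eq hq hκ0 hκ hlam hmu hx h1 h2 h3 h4, ?_⟩
  obtain ⟨hev, hcont⟩ := QEuler.continuousAt_discreteSum hq hlam hx h1 h3
  obtain ⟨hev', hcont'⟩ := QEuler.continuousAt_discreteSum hq hmu hx h2 h4
  -- The difference of sums is continuous at `x` and agrees with the quotient on a punctured
  -- neighbourhood, whether or not `e_q(-q/x)` vanishes.
  refine ((hcont.sub hcont').tendsto.mono_left nhdsWithin_le_nhds).congr' ?_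
  filter_upwards [nhdsWithin_le_nhds hev, nhdsWithin_le_nhds hev',
    QEuler.eventually_qExp_ne_zero hq hx] with z hz hz' hE
  exact QEuler.discreteSum_sub_eq hq hκ0 hκ hlam hmu hz.1 h1 h2 hz.2 hz'.2 hE
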